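/- Let $S$ be a countable (finite or countably infinite) set and let $P=(P_{ij})_{i,j\in S}$ be a stochastic matrix, not assumed irreducible. Let $(X_n)_{n\ge 0}$ be a time-homogeneous discrete-time Markov chain with state space $S$, transition matrix $P$ and arbitrary initial distribution $\mu^{(0)}_i=\mathbb P(X_0=i)$, and put $\mu^{(k)}_j=\mathbb P(X_k=j)$. Let $\mathbb P_i=\mathbb P(\,\cdot\mid X_0=i)$ denote the law of the Markov chain with transition matrix $P$ started at $i$. Write $$f_{ij}=\mathbb P_i(\exists\, n\ge 1:\ X_n=j),\qquad m_j=\mathbb E_j\big[\min\{n\ge 1: X_n=j\}\big]\in[1,\infty]\qquad(\min\emptyset=\infty),$$ and call $j$ positive recurrent if $f_{jj}=1$ and $m_j<\infty$. Then for all $i,j\in S$ the following limits exist and have the stated values: $$\lim_{n\to\infty}\frac1n\sum_{k=1}^n\mu^{(k)}_j=\begin{cases}\dfrac1{m_j}\displaystyle\sum_{l\in S}\mu^{(0)}_l f_{lj}, & j\text{ positive recurrent},\\[2mm] 0,&\text{otherwise,}\end{cases}$$ and $$\lim_{n\to\infty}\frac1n\sum_{k=1}^n (P^k)_{ij}=\begin{cases}\dfrac{f_{ij}}{m_j},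 & j\text{ positive recurrent},\\[2mm] 0,&\text{otherwise.}\end{cases}$$ -/

import Mathlib

open MeasureTheory ProbabilityTheory Filter Topology
open scoped ENNReal

namespace CountableMarkovChain

variable {S : Type*}

/-- The entries `(P ^ k) i j` of the powers of a stochastic matrix `P` on a countable set.  A
stochastic matrix is given by its rows, which are probability mass functions.  `PMF.bind` is the
product of a row vector with a matrix: `(μ.bind P) j = ∑' l, μ l * P l j`. -/
noncomputable def matPow (P : S → PMF S) : ℕ → S → PMF S
  | 0, i => PMF.pure i
  | k + 1, i => (matPow P k i).bind P

/-- `X` is a (time-homogeneous, discrete-time) Markov chain under `μ` with transition matrix `P`: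
`μ(X_{n+1} = x_{n+1} | X_0 = x_0, …, X_n = x_n) = P x_n x_{n+1}` whenever the conditioning event
has positive probability.  The initial distribution is arbitrary. -/
structure IsMarkovChain {Ω : Type*} [MeasurableSpace Ω] [MeasurableSpace S] (μ : Measure Ω)
    (X : ℕ → Ω → S) (P : S → PMF S) : Prop where
  measurable : ∀ n, Measurable (X n)
  markov : ∀ (n : ℕ) (x : ℕ → S), μ {ω | ∀ k ≤ n, X k ω = x k} ≠ 0 →
    μ[|{ω | ∀ k ≤ n, X k ω = x k}] {ω | X (n + 1) ω = x (n + 1)} = P (x n) (x (n + 1))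

section PathSpace

variable [Countable S] [MeasurableSpace S] [DiscreteMeasurableSpace S]

/-- The transition kernel of the matrix `P`: `transKernel P i {j} = P i j`. -/
noncomputable def transKernel (P : S → PMF S) : Kernel S S where
  toFun i := (P i).toMeasure
  measurable' := .of_discrete

instance (P : S → PMF S) : IsMarkovKernel (transKernel P) :=
  ⟨fun i => PMF.toMeasure.isProbabilityMeasure (P i)⟩

/-- The next state given the history up to time `n`; it depends on the last state only. -/
noncomputable def histKernel (P : S → PMF S) (n : ℕ) :
    Kernel (Finset.Iic n → S) S :=
  (transKernel P).comap (fun h => h ⟨n, Finset.mem_Iic.2 le_rfl⟩) (measurable_pi_apply _)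

instance (P : S → PMF S) (n : ℕ) : IsMarkovKernel (histKernel P n) :=
  inferInstanceAs (IsMarkovKernel ((transKernel P).comap _ _))

/-- `ℙ(· | X_0 = i)`: the law, on the space of trajectories, of the Markov chain with transition
matrix `P` started at `i` (Ionescu-Tulcea). -/
noncomputable def pathMeasure (P : S → PMF S) (i : S) : Measure (ℕ → S) :=
  Kernel.traj (X := fun _ => S) (histKernel P) 0 (fun _ => i)

/-- `f_{ij}`: the probability that the chain started at `i` visits `j` at some time `n ≥ 1`. -/
noncomputable def hitProb (P : S → PMF S) (i j : S) : ℝ :=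
  (pathMeasure P i).real {x | ∃ n : ℕ, 1 ≤ n ∧ x n = j}

/-- The first time `n ≥ 1` at which the trajectory `x` is at `j` (`∞` if there is none). -/
noncomputable def returnTime (j : S) (x : ℕ → S) : ℝ≥0∞ :=
  ⨅ (n : ℕ) (_ : 1 ≤ n ∧ x n = j), (n : ℝ≥0∞)

/-- `m_j`: the expected return time to `j` of the chain started at `j`, in `[1, ∞]`. -/
noncomputable def meanReturnTime (P : S → PMF S) (j : S) : ℝ≥0∞ :=
  ∫⁻ x, returnTime j x ∂(pathMeasure P j)

/-- `j` is positive recurrent: the return to `j` is certain and its mean time is finite. -/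
def IsPositiveRecurrent (P : S → PMF S) (j : S) : Prop :=
  hitProb P j j = 1 ∧ meanReturnTime P j < ∞

end PathSpace

end CountableMarkovChain

/-!
The limits come from the elementary renewal theorem, which needs neither irreducibility nor
aperiodicity because it only concerns averages.

Fix `j` and let `T ≥ 1` be the first return time. With `f k = ℙ_j(T = k + 1)`, `r k = ℙ_j(T > k)` and
`u n = (P ^ n) j j`, the renewal equation `u (n + 1) = ∑ k ≤ n, f k * u (n - k)` and
`r (k + 1) = r k - f k` give `∑ k ≤ n, r k * u (n - k) = 1` for every `n`. Summing over `n < N` gives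
`∑ k < N, r k * U (N - k) = N`, where `U` denotes the partial sums of `u`. Since
`U N - k ≤ U (N - k) ≤ U N`, the quotient `U N / N` lies between `1 / ∑ k, r k` and
`1 / (∑ k < K, r k) + K / N` whenever `1 ≤ K ≤ N`, so it tends to `1 / ∑ k, r k = 1 / m_j`, which is `0` when
`m_j = ∞` (`tendsto_average_renewal`, `meanReturnTime_eq_tsum`).

For a chain with an arbitrary initial distribution, decomposing a visit to `j` at the first visit
exhibits `μ(X (n + 1) = j)` as a delayed renewal sequence
(`IsMarkovChain.measure_eq_sum_firstHitSet`), and dominated convergence shows that its averages tend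
to `μ(X ever visits j) / m_j` (`IsMarkovChain.tendsto_average`). Applied to the given chain and to the
chain on trajectories started at `i`, this yields both limits, because `μ(X ever visits j)` is the mean
of `hitProb P l j` under the initial distribution (`IsMarkovChain.hasSum_hitProb`), and `m_j = ∞`
unless `j` is positive recurrent.
-/

namespace CountableMarkovChain

/-! ### Renewal sequences -/

/-- Summing a convolution `∑ k ≤ n, f k * g (n - k)` over `n < N` convolves `f` with the partial
sums of `g`. -/
lemma sum_range_convolution (f g : ℕ → ℝ) (N : ℕ) :
    ∑ n ∈ Finset.range N, ∑ k ∈ Finset.range (n + 1), f k * g (n - k) =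
      ∑ k ∈ Finset.range N, f k * ∑ b ∈ Finset.range (N - k), g b := by
  induction N with
  | zero => simp
  | succ N ih =>
    have hstep : ∀ k ∈ Finset.range (N + 1), f k * ∑ b ∈ Finset.range (N + 1 - k), g b =
        f k * ∑ b ∈ Finset.range (N - k), g b + f k * g (N - k) := by
      intro k hk
      rw [Nat.sub_add_comm (Nat.lt_succ_iff.1 (Finset.mem_range.1 hk)), Finset.sum_range_succ,
        mul_add]
    rw [Finset.sum_range_succ, ih, Finset.sum_congr rfl hstep, Finset.sum_add_distrib,
      Finset.sum_range_succ (fun k => f k * ∑ b ∈ Finset.range (N - k), g b) N]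
    simp

/-- If `u` is the renewal sequence of the waiting-time distribution `f` and `r` is the sequence of
tails of `f`, then `r` convolved with `u` is constantly `1` (decomposition at the last renewal). -/
lemma sum_tail_mul_renewal {f r u : ℕ → ℝ} (hu0 : u 0 = 1) (hr0 : r 0 = 1)
    (hr : ∀ k, r (k + 1) = r k - f k)
    (hu : ∀ n, u (n + 1) = ∑ k ∈ Finset.range (n + 1), f k * u (n - k)) (n : ℕ) :
    ∑ k ∈ Finset.range (n + 1), r k * u (n - k) = 1 := by
  induction n with
  | zero => simp [hu0, hr0]
  | succ n ih =>
    rw [Finset.sum_range_succ']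
    simp only [hr, Nat.add_sub_add_right, sub_mul, Finset.sum_sub_distrib, ih, hr0, Nat.sub_zero,
      one_mul, ← hu]
    ring

lemma sum_tail_mul_sum_renewal {f r u : ℕ → ℝ} (hu0 : u 0 = 1) (hr0 : r 0 = 1)
    (hr : ∀ k, r (k + 1) = r k - f k)
    (hu : ∀ n, u (n + 1) = ∑ k ∈ Finset.range (n + 1), f k * u (n - k)) (N : ℕ) :
    ∑ k ∈ Finset.range N, r k * ∑ b ∈ Finset.range (N - k), u b = N := by
  rw [← sum_range_convolution]
  simp [sum_tail_mul_renewal hu0 hr0 hr hu]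

/-- The elementary renewal theorem in analytic form: the averages of the renewal sequence `u` tend
to the inverse of the sum of the tails `r`, which is `0` when the tails are not summable. -/
theorem tendsto_average_renewal {r u : ℕ → ℝ} (hr0 : r 0 = 1) (hrnn : ∀ k, 0 ≤ r k)
    (hunn : ∀ k, 0 ≤ u k) (hu1 : ∀ k, u k ≤ 1)
    (hconv : ∀ N : ℕ, ∑ k ∈ Finset.range N, r k * ∑ b ∈ Finset.range (N - k), u b = N) :
    Tendsto (fun N : ℕ => (∑ b ∈ Finset.range N, u b) / N) atTop
      (𝓝 ((∑' k, ENNReal.ofReal (r k))⁻¹).toReal) := by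
  set U : ℕ → ℝ := fun N => ∑ b ∈ Finset.range N, u b with hU
  set R : ℕ → ℝ := fun K => ∑ k ∈ Finset.range K, r k with hR
  set m : ℝ≥0∞ := ∑' k, ENNReal.ofReal (r k) with hm
  have hUnn : ∀ N, 0 ≤ U N := fun N => Finset.sum_nonneg fun b _ => hunn b
  have hUmono : Monotone U := fun a b hab =>
    Finset.sum_le_sum_of_subset_of_nonneg (Finset.range_mono hab) fun i _ _ => hunn i
  have hUsub : ∀ N k : ℕ, U N - k ≤ U (N - k) := by
    intro N k
    induction k with
    | zero => simp
    | succ k ih =>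
      have : U (N - k) ≤ U (N - (k + 1)) + 1 := by
        rcases Nat.eq_zero_or_pos (N - k) with h | h
        · rw [h]
          have : U 0 = 0 := by simp [hU]
          linarith [hUnn (N - (k + 1))]
        · obtain ⟨p, hp⟩ : ∃ p, N - k = p + 1 := ⟨N - k - 1, by omega⟩
          have hp' : N - (k + 1) = p := by omega
          rw [hp, hp']
          simp only [hU, Finset.sum_range_succ]
          linarith [hu1 p]
      push_cast
      linarith
  have hRle : ∀ K, ENNReal.ofReal (R K) ≤ m := by
    intro K
    rw [hR, ENNReal.ofReal_sum_of_nonneg fun k _ => hrnn k]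
    exact ENNReal.sum_le_tsum _
  have hm1 : 1 ≤ m := by simpa [hR, hr0] using hRle 1
  have hm0 : m ≠ 0 := (zero_lt_one.trans_le hm1).ne'
  have hRpos : ∀ K, 1 ≤ K → 0 < R K := fun K hK =>
    Finset.sum_pos' (fun k _ => hrnn k) ⟨0, Finset.mem_range.2 hK, by simp [hr0]⟩
  have hRlim : Tendsto (fun K => (R K)⁻¹) atTop (𝓝 (m⁻¹).toReal) := by
    have h1 : Tendsto (fun K => ENNReal.ofReal (R K)) atTop (𝓝 m) := by
      simp only [hR, ENNReal.ofReal_sum_of_nonneg fun k _ => hrnn k]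
      exact ENNReal.tendsto_nat_tsum _
    have h2 : Tendsto (fun K => ((ENNReal.ofReal (R K))⁻¹).toReal) atTop (𝓝 (m⁻¹).toReal) :=
      (ENNReal.tendsto_toReal (ENNReal.inv_ne_top.2 hm0)).comp (tendsto_inv_iff.2 h1)
    refine h2.congr fun K => ?_
    rw [ENNReal.toReal_inv, ENNReal.toReal_ofReal (Finset.sum_nonneg fun k _ => hrnn k)]
  have hlower : ∀ N : ℕ, 1 ≤ N → (m⁻¹).toReal ≤ U N / N := by
    intro N hN
    have hNpos : (0 : ℝ) < N := by exact_mod_cast hN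
    rcases eq_or_ne m ∞ with h | h
    · simpa [h] using div_nonneg (hUnn N) hNpos.le
    · have hRm : R N ≤ m.toReal := by
        rw [← ENNReal.ofReal_le_iff_le_toReal h]
        exact hRle N
      have h1 : (N : ℝ) ≤ R N * U N := by
        rw [← hconv N, hR, Finset.sum_mul]
        exact Finset.sum_le_sum fun k _ =>
          mul_le_mul_of_nonneg_left (hUmono (Nat.sub_le N k)) (hrnn k)
      have h2 : (N : ℝ) ≤ m.toReal * U N :=
        h1.trans (mul_le_mul_of_nonneg_right hRm (hUnn N))
      rw [ENNReal.toReal_inv, inv_eq_one_div,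
        div_le_div_iff₀ (ENNReal.toReal_pos hm0 h) hNpos]
      linarith
  have hupper : ∀ K N : ℕ, 1 ≤ K → K ≤ N → 1 ≤ N →
      U N / N ≤ (R K)⁻¹ + (K : ℝ) / N := by
    intro K N hK hKN hN
    have hNpos : (0 : ℝ) < N := by exact_mod_cast hN
    have h1 : R K * (U N - K) ≤ N := by
      rw [← hconv N, hR, Finset.sum_mul]
      calc ∑ k ∈ Finset.range K, r k * (U N - K)
          ≤ ∑ k ∈ Finset.range K, r k * U (N - k) := by
            refine Finset.sum_le_sum fun k hk => mul_le_mul_of_nonneg_left ?_ (hrnn k)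
            have : (k : ℝ) ≤ K := by exact_mod_cast (Finset.mem_range.1 hk).le
            linarith [hUsub N k]
        _ ≤ ∑ k ∈ Finset.range N, r k * U (N - k) :=
            Finset.sum_le_sum_of_subset_of_nonneg (Finset.range_mono hKN)
              fun k _ _ => mul_nonneg (hrnn k) (hUnn _)
    have h2 : U N - K ≤ N * (R K)⁻¹ := by
      rw [← div_eq_mul_inv, le_div_iff₀ (hRpos K hK)]
      linarith
    rw [div_le_iff₀ hNpos, add_mul, div_mul_cancel₀ _ hNpos.ne']
    linarith
  rw [tendsto_order]
  constructor
  · intro a ha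
    filter_upwards [eventually_ge_atTop 1] with N hN using ha.trans_le (hlower N hN)
  · intro a ha
    obtain ⟨K, hK, hKa⟩ := ((eventually_ge_atTop 1).and (hRlim.eventually_lt_const ha)).exists
    have hlim : Tendsto (fun N : ℕ => (R K)⁻¹ + (K : ℝ) / N) atTop (𝓝 ((R K)⁻¹ + 0)) :=
      tendsto_const_nhds.add (tendsto_const_div_atTop_nhds_zero_nat _)
    rw [add_zero] at hlim
    filter_upwards [eventually_ge_atTop 1, eventually_ge_atTop K, hlim.eventually_lt_const hKa]
      with N hN hKN hlt using (hupper K N hK hKN hN).trans_lt hlt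

/-- Averages of a delayed renewal sequence `a`: if the delay has the (possibly defective)
distribution `g`, the averages of `a` converge to the total mass of `g` times the limit of the
averages of `u`. -/
theorem tendsto_average_delayed_renewal {g u a : ℕ → ℝ} {L : ℝ} (hg : ∀ k, 0 ≤ g k)
    (hgs : Summable g) (hunn : ∀ k, 0 ≤ u k) (hu1 : ∀ k, u k ≤ 1)
    (hL : Tendsto (fun N : ℕ => (∑ b ∈ Finset.range N, u b) / N) atTop (𝓝 L))
    (ha : ∀ n, a (n + 1) = ∑ k ∈ Finset.range (n + 1), g k * u (n - k)) :
    Tendsto (fun n : ℕ => (∑ k ∈ Finset.Icc 1 n, a k) / n) atTop (𝓝 ((∑' k, g k) * L)) := by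
  set U : ℕ → ℝ := fun N => ∑ b ∈ Finset.range N, u b with hU
  have hUnn : ∀ N, 0 ≤ U N := fun N => Finset.sum_nonneg fun b _ => hunn b
  have hUle : ∀ N : ℕ, U N ≤ N := fun N => by
    simpa using Finset.sum_le_sum (s := Finset.range N) fun b _ => hu1 b
  have hsum : ∀ n : ℕ, (∑ k ∈ Finset.Icc 1 n, a k) / n = ∑' k, g k * (U (n - k) / n) := by
    intro n
    have h1 : ∑ k ∈ Finset.Icc 1 n, a k = ∑ k ∈ Finset.range n, a (k + 1) := by
      rw [Finset.range_eq_Ico, Finset.sum_Ico_add' a 0 n 1]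
      rfl
    rw [h1, Finset.sum_congr rfl fun k _ => ha k, sum_range_convolution, Finset.sum_div,
      tsum_eq_sum (s := Finset.range n)]
    · exact Finset.sum_congr rfl fun k _ => mul_div_assoc _ _ _
    · intro k hk
      have : n - k = 0 := by simpa [Nat.sub_eq_zero_iff_le] using hk
      simp [this, hU]
  simp only [hsum]
  rw [← tsum_mul_right]
  refine tendsto_tsum_of_dominated_convergence (bound := g) hgs (fun k => ?_) ?_
  · refine Tendsto.const_mul _ ?_
    -- `U (n - k) / n` is the average over `n - k` terms times the ratio `(n - k) / n`.
    have h1 : Tendsto (fun n : ℕ => U (n - k) / ((n - k : ℕ) : ℝ)) atTop (𝓝 L) :=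
      hL.comp (tendsto_sub_atTop_nat k)
    have h2 : Tendsto (fun n : ℕ => ((n - k : ℕ) : ℝ) / n) atTop (𝓝 1) := by
      have h3 : Tendsto (fun n : ℕ => 1 - (k : ℝ) / n) atTop (𝓝 (1 - 0)) :=
        tendsto_const_nhds.sub (tendsto_const_div_atTop_nhds_zero_nat _)
      rw [sub_zero] at h3
      refine h3.congr' ?_
      filter_upwards [eventually_ge_atTop (k + 1)] with n hn
      have hn0 : (n : ℝ) ≠ 0 := by
        have : n ≠ 0 := by omega
        exact_mod_cast this
      rw [Nat.cast_sub (by omega), sub_div, div_self hn0]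
    have h4 := h1.mul h2
    rw [mul_one] at h4
    refine h4.congr' ?_
    filter_upwards [eventually_ge_atTop (k + 1)] with n hn
    have hn0 : ((n - k : ℕ) : ℝ) ≠ 0 := by
      have : n - k ≠ 0 := by omega
      exact_mod_cast this
    exact div_mul_div_cancel₀ hn0
  · refine Eventually.of_forall fun n k => ?_
    have hle : U (n - k) / n ≤ 1 := by
      refine div_le_one_of_le₀ ((hUle _).trans ?_) n.cast_nonneg
      exact_mod_cast Nat.sub_le n k
    have hnn : 0 ≤ U (n - k) / n := div_nonneg (hUnn _) n.cast_nonneg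
    rw [Real.norm_of_nonneg (mul_nonneg (hg k) hnn)]
    exact mul_le_of_le_one_right (hg k) hle

variable {S Ω : Type*}

/-! ### The Markov property for events of the past -/

/-- `A` is an event of the past of `X` at time `n`: whether `ω ∈ A` is decided by the values
`X 0 ω, …, X n ω`. -/
def IsPast (X : ℕ → Ω → S) (n : ℕ) (A : Set Ω) : Prop :=
  ∀ ⦃ω ω'⦄, (∀ k ≤ n, X k ω = X k ω') → ω ∈ A → ω' ∈ A

lemma IsPast.mono {X : ℕ → Ω → S} {n m : ℕ} {A : Set Ω} (hA : IsPast X n A) (h : n ≤ m) :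
    IsPast X m A :=
  fun _ _ hω => hA fun k hk => hω k (hk.trans h)

lemma IsPast.inter {X : ℕ → Ω → S} {n : ℕ} {A B : Set Ω} (hA : IsPast X n A)
    (hB : IsPast X n B) : IsPast X n (A ∩ B) :=
  fun _ _ hω h => ⟨hA hω h.1, hB hω h.2⟩

lemma isPast_univ (X : ℕ → Ω → S) (n : ℕ) : IsPast X n Set.univ := fun _ _ _ h => h

lemma isPast_eq (X : ℕ → Ω → S) {k n : ℕ} (h : k ≤ n) (s : S) : IsPast X n {ω | X k ω = s} :=
  fun _ _ hω hs => (hω k h).symm.trans hs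

/-- The event that `X` is not at `j` at any of the times `1, …, k`. -/
def avoidSet (X : ℕ → Ω → S) (j : S) (k : ℕ) : Set Ω := {ω | ∀ n, 1 ≤ n → n ≤ k → X n ω ≠ j}

/-- The event that the first visit of `X` to `j` at a positive time happens at time `k + 1`. -/
def firstHitSet (X : ℕ → Ω → S) (j : S) (k : ℕ) : Set Ω := avoidSet X j k ∩ {ω | X (k + 1) ω = j}

/-- The event that `X` is at `j` at some positive time. -/
def hitSet (X : ℕ → Ω → S) (j : S) : Set Ω := {ω | ∃ n, 1 ≤ n ∧ X n ω = j}

lemma isPast_avoidSet (X : ℕ → Ω → S) (j : S) (k : ℕ) : IsPast X k (avoidSet X j k) :=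
  fun _ _ hω h n h1 hn => hω n hn ▸ h n h1 hn

lemma avoidSet_zero (X : ℕ → Ω → S) (j : S) : avoidSet X j 0 = Set.univ := by
  ext ω
  simp only [avoidSet, Set.mem_ofPred_eq, Set.mem_univ, iff_true]
  intro n h1 h0
  omega

lemma avoidSet_succ (X : ℕ → Ω → S) (j : S) (k : ℕ) :
    avoidSet X j (k + 1) = avoidSet X j k \ firstHitSet X j k := by
  ext ω
  constructor
  · exact fun h => ⟨fun n h1 hn => h n h1 (hn.trans k.le_succ),
      fun h' => h (k + 1) (by omega) le_rfl h'.2⟩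
  · rintro ⟨h, h'⟩ n h1 hn
    rcases hn.lt_or_eq with hlt | rfl
    · exact h n h1 (Nat.lt_succ_iff.1 hlt)
    · exact fun hj => h' ⟨h, hj⟩

lemma avoidSet_succ_inter_self (X : ℕ → Ω → S) (j : S) (k : ℕ) :
    avoidSet X j (k + 1) ∩ {ω | X (k + 1) ω = j} = ∅ :=
  Set.eq_empty_of_forall_notMem fun _ hω => hω.1 (k + 1) (by omega) le_rfl hω.2

lemma avoidSet_succ_inter_of_ne (X : ℕ → Ω → S) {j r : S} (hr : r ≠ j) (k : ℕ) :
    avoidSet X j (k + 1) ∩ {ω | X (k + 1) ω = r} = avoidSet X j k ∩ {ω | X (k + 1) ω = r} := by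
  rw [avoidSet_succ]
  ext ω
  exact ⟨fun h => ⟨h.1.1, h.2⟩, fun h => ⟨⟨h.1, fun h' => hr (h.2.symm.trans h'.2)⟩, h.2⟩⟩

lemma pairwise_disjoint_firstHitSet (X : ℕ → Ω → S) (j : S) :
    Pairwise (Function.onFun Disjoint (firstHitSet X j)) := by
  have key : ∀ a b : ℕ, a < b → Disjoint (firstHitSet X j a) (firstHitSet X j b) :=
    fun a b hab => Set.disjoint_left.2 fun ω ha hb =>
      hb.1 (a + 1) (by omega) (by omega) ha.2
  intro a b hab
  rcases hab.lt_or_gt with h | h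
  exacts [key a b h, (key b a h).symm]

/-- A visit to `j` during the times `1, …, n` has a first one. -/
lemma exists_mem_firstHitSet {X : ℕ → Ω → S} {j : S} {n : ℕ} {ω : Ω} (hn : 1 ≤ n)
    (h : X n ω = j) : ∃ k < n, ω ∈ firstHitSet X j k := by
  classical
  have hex : ∃ m, 1 ≤ m ∧ X m ω = j := ⟨n, hn, h⟩
  obtain ⟨h1, h2⟩ := Nat.find_spec hex
  have hle : Nat.find hex ≤ n := Nat.find_min' hex ⟨hn, h⟩
  have hs : Nat.find hex - 1 + 1 = Nat.find hex := by omega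
  refine ⟨Nat.find hex - 1, by omega, fun m hm1 hm hmj => ?_, ?_⟩
  · exact Nat.find_min hex (by omega) ⟨hm1, hmj⟩
  · simpa only [Set.mem_ofPred_eq, hs] using h2

lemma hitSet_eq_iUnion (X : ℕ → Ω → S) (j : S) : hitSet X j = ⋃ k, firstHitSet X j k := by
  ext ω
  simp only [Set.mem_iUnion]
  constructor
  · rintro ⟨n, hn, h⟩
    obtain ⟨k, -, hk⟩ := exists_mem_firstHitSet hn h
    exact ⟨k, hk⟩
  · rintro ⟨k, hk⟩
    exact ⟨k + 1, by omega, hk.2⟩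

/-- The first return time is the number of `k` such that `j` is avoided at the times `1, …, k`. -/
lemma returnTime_eq_tsum (j : S) (x : ℕ → S) :
    returnTime j x = ∑' k, (avoidSet (fun n (x : ℕ → S) => x n) j k).indicator 1 x := by
  classical
  by_cases hex : ∃ n, 1 ≤ n ∧ x n = j
  · set N := Nat.find hex with hN
    obtain ⟨hN1, hNj⟩ := Nat.find_spec hex
    have hmem : ∀ k, x ∈ avoidSet (fun n (x : ℕ → S) => x n) j k ↔ k < N := by
      intro k
      constructor
      · intro h
        by_contra hlt
        exact h N hN1 (not_lt.1 hlt) hNj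
      · exact fun hk n hn1 hn hj => Nat.find_min hex (hn.trans_lt hk) ⟨hn1, hj⟩
    have h1 : returnTime j x = N := by
      refine le_antisymm (iInf₂_le N ⟨hN1, hNj⟩) (le_iInf₂ fun n hn => ?_)
      exact_mod_cast Nat.find_min' hex hn
    rw [h1, tsum_eq_sum (s := Finset.range N)]
    · rw [Finset.sum_congr rfl fun k hk =>
        Set.indicator_of_mem ((hmem k).2 (Finset.mem_range.1 hk)) _]
      simp
    · intro k hk
      exact Set.indicator_of_notMem (fun h => hk (Finset.mem_range.2 ((hmem k).1 h))) _
  · have h1 : returnTime j x = ∞ := by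
      simp only [returnTime, iInf_eq_top]
      exact fun n hn => absurd ⟨n, hn⟩ hex
    have hmem : ∀ k, x ∈ avoidSet (fun n (x : ℕ → S) => x n) j k :=
      fun k n hn _ hj => hex ⟨n, hn, hj⟩
    rw [h1, tsum_congr fun k => Set.indicator_of_mem (hmem k) _]
    simp

variable [Countable S] [MeasurableSpace S] [DiscreteMeasurableSpace S] [MeasurableSpace Ω]

/-- Decomposition of an event according to the value of a random variable with countably many
values. -/
lemma measure_eq_tsum_inter_preimage {T : Type*} [Countable T] [MeasurableSpace T]
    [MeasurableSingletonClass T] (μ : Measure Ω) {Y : Ω → T} (hY : Measurable Y) {A : Set Ω}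
    (hA : MeasurableSet A) : μ A = ∑' t, μ (A ∩ {ω | Y ω = t}) := by
  have hAU : A = ⋃ t, A ∩ {ω | Y ω = t} := by
    ext ω
    simp
  conv_lhs => rw [hAU]
  refine measure_iUnion (fun s t hst => Set.disjoint_left.2 fun ω hs ht => hst ?_)
    fun t => hA.inter (hY (measurableSet_singleton t))
  exact hs.2.symm.trans ht.2

lemma IsPast.measurableSet {X : ℕ → Ω → S} (hX : ∀ n, Measurable (X n)) {n : ℕ} {A : Set Ω}
    (hA : IsPast X n A) : MeasurableSet A := by
  have hm : Measurable fun ω (k : Fin (n + 1)) => X k ω := measurable_pi_lambda _ fun k => hX k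
  have hpre : A = (fun ω (k : Fin (n + 1)) => X k ω) ⁻¹'
      ((fun ω (k : Fin (n + 1)) => X k ω) '' A) := by
    refine (Set.subset_preimage_image _ _).antisymm ?_
    rintro ω' ⟨ω, hω, h⟩
    exact hA (fun k hk => congrFun h ⟨k, Nat.lt_succ_of_le hk⟩) hω
  rw [hpre]
  exact hm (Set.to_countable _).measurableSet

lemma measurableSet_avoidSet {X : ℕ → Ω → S} (hX : ∀ n, Measurable (X n)) (j : S) (k : ℕ) :
    MeasurableSet (avoidSet X j k) :=
  (isPast_avoidSet X j k).measurableSet hX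

lemma measurableSet_firstHitSet {X : ℕ → Ω → S} (hX : ∀ n, Measurable (X n)) (j : S) (k : ℕ) :
    MeasurableSet (firstHitSet X j k) :=
  (measurableSet_avoidSet hX j k).inter (hX _ (measurableSet_singleton j))

lemma measurableSet_hitSet {X : ℕ → Ω → S} (hX : ∀ n, Measurable (X n)) (j : S) :
    MeasurableSet (hitSet X j) := by
  rw [hitSet_eq_iUnion]
  exact MeasurableSet.iUnion (measurableSet_firstHitSet hX j)

section Chain

variable {μ : Measure Ω} [IsProbabilityMeasure μ] {X : ℕ → Ω → S} {P : S → PMF S}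

/-- The one-step Markov property, for arbitrary events of the past instead of cylinders. -/
lemma IsMarkovChain.measure_inter_next (hX : IsMarkovChain μ X P) {n : ℕ} {A : Set Ω}
    (hA : IsPast X n A) (s t : S) :
    μ (A ∩ {ω | X n ω = s} ∩ {ω | X (n + 1) ω = t}) = μ (A ∩ {ω | X n ω = s}) * P s t := by
  set H : Ω → Fin (n + 1) → S := fun ω k => X k ω with hH
  have hHm : Measurable H := measurable_pi_lambda _ fun k => hX.measurable k
  have hAs : IsPast X n (A ∩ {ω | X n ω = s}) := hA.inter (isPast_eq X le_rfl s)
  have hAm := hAs.measurableSet hX.measurable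
  have htm : MeasurableSet {ω | X (n + 1) ω = t} :=
    hX.measurable _ (measurableSet_singleton t)
  rw [measure_eq_tsum_inter_preimage μ hHm (hAm.inter htm),
    measure_eq_tsum_inter_preimage μ hHm hAm, ← ENNReal.tsum_mul_right]
  refine tsum_congr fun h => ?_
  rw [Set.inter_right_comm]
  -- The atom of the history `h` is disjoint from the event or contained in it.
  by_cases hne : ∃ ω₀ ∈ A ∩ {ω | X n ω = s}, H ω₀ = h
  · obtain ⟨ω₀, hω₀, rfl⟩ := hne
    set x : ℕ → S := fun k => if k ≤ n then X k ω₀ else t with hx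
    have hcyl : A ∩ {ω | X n ω = s} ∩ {ω | H ω = H ω₀} = {ω | ∀ k ≤ n, X k ω = x k} := by
      ext ω
      constructor
      · rintro ⟨-, hω⟩ k hk
        rw [hx]
        simpa [hk] using congrFun hω ⟨k, Nat.lt_succ_of_le hk⟩
      · intro hω
        have hω' : ∀ k ≤ n, X k ω = X k ω₀ := fun k hk => by
          simpa [hx, hk] using hω k hk
        exact ⟨hAs (fun k hk => (hω' k hk).symm) hω₀,
          funext fun k => hω' k (Nat.lt_succ_iff.1 k.2)⟩
    have hxn : x n = s := by simpa [hx] using hω₀.2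
    have hxt : x (n + 1) = t := by simp [hx]
    rw [hcyl]
    by_cases h0 : μ {ω | ∀ k ≤ n, X k ω = x k} = 0
    · rw [h0, zero_mul]
      exact measure_mono_null Set.inter_subset_left h0
    · have hm : MeasurableSet {ω | ∀ k ≤ n, X k ω = x k} := by
        rw [← hcyl]
        exact hAm.inter (hHm (measurableSet_singleton _))
      have := hX.markov n x h0
      rw [cond_apply hm, hxn, hxt] at this
      rw [← this, ← mul_assoc, ENNReal.mul_inv_cancel h0 (measure_ne_top _ _), one_mul]
  · have hempty : A ∩ {ω | X n ω = s} ∩ {ω | H ω = h} = ∅ :=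
      Set.eq_empty_of_forall_notMem fun ω hω => hne ⟨ω, hω.1, hω.2⟩
    simp [hempty]

/-- The Markov property over `m` steps. -/
lemma IsMarkovChain.measure_inter_add (hX : IsMarkovChain μ X P) {n : ℕ} {A : Set Ω}
    (hA : IsPast X n A) (s : S) (m : ℕ) (t : S) :
    μ (A ∩ {ω | X n ω = s} ∩ {ω | X (n + m) ω = t}) =
      μ (A ∩ {ω | X n ω = s}) * matPow P m s t := by
  have hAs : IsPast X n (A ∩ {ω | X n ω = s}) := hA.inter (isPast_eq X le_rfl s)
  induction m generalizing t with
  | zero =>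
    simp only [matPow, PMF.pure_apply, Nat.add_zero]
    split_ifs with h
    · rw [h, Set.inter_assoc, Set.inter_self, mul_one]
    · rw [mul_zero]
      convert measure_empty (μ := μ)
      refine Set.eq_empty_of_forall_notMem fun ω hω => h (hω.2.symm.trans hω.1.2)
  | succ m ih =>
    have hm : MeasurableSet (A ∩ {ω | X n ω = s} ∩ {ω | X (n + (m + 1)) ω = t}) :=
      (hAs.measurableSet hX.measurable).inter (hX.measurable _ (measurableSet_singleton t))
    rw [measure_eq_tsum_inter_preimage μ (hX.measurable (n + m)) hm]
    simp only [matPow, PMF.bind_apply]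
    rw [← ENNReal.tsum_mul_left]
    refine tsum_congr fun r => ?_
    rw [Set.inter_right_comm, ← add_assoc,
      hX.measure_inter_next (hAs.mono (Nat.le_add_right n m)), ih, mul_assoc]

/-- Renewal equation: decomposition of a visit to `j` at time `n + 1` at the first visit. -/
lemma IsMarkovChain.measure_eq_sum_firstHitSet (hX : IsMarkovChain μ X P) (j : S) (n : ℕ) :
    μ {ω | X (n + 1) ω = j} =
      ∑ k ∈ Finset.range (n + 1), μ (firstHitSet X j k) * matPow P (n - k) j j := by
  have hU : {ω | X (n + 1) ω = j} =
      ⋃ k ∈ Finset.range (n + 1), firstHitSet X j k ∩ {ω | X (n + 1) ω = j} := by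
    ext ω
    simp only [Set.mem_iUnion, Set.mem_inter_iff, exists_and_right, Finset.mem_range,
      exists_prop]
    refine ⟨fun h => ⟨?_, h⟩, fun h => h.2⟩
    exact exists_mem_firstHitSet (by omega) h
  have hm : ∀ k, MeasurableSet (firstHitSet X j k ∩ {ω | X (n + 1) ω = j}) := fun k =>
    (measurableSet_firstHitSet hX.measurable j k).inter
      (hX.measurable _ (measurableSet_singleton j))
  conv_lhs => rw [hU]
  rw [measure_biUnion_finset (fun a _ b _ hab => ?_) fun k _ => hm k]
  · refine Finset.sum_congr rfl fun k hk => ?_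
    have hk' : n + 1 = k + 1 + (n - k) := by
      have := Finset.mem_range.1 hk
      omega
    have := hX.measure_inter_add ((isPast_avoidSet X j k).mono k.le_succ) j (n - k) j
    rw [← hk'] at this
    exact this
  · exact (pairwise_disjoint_firstHitSet X j hab).mono Set.inter_subset_left
      Set.inter_subset_left

/-- Comparison of a chain on the event `X 0 = l` with a chain started at `l` that has the same
transition matrix. The probabilities of avoiding `j` up to time `n` and then moving to `s` satisfy
the same linear recursion in `n`; for `s = j` these are the first-hit probabilities. -/
lemma IsMarkovChain.measure_avoidSet_inter {Ω' : Type*} [MeasurableSpace Ω'] {ν : Measure Ω'}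
    [IsProbabilityMeasure ν] {Y : ℕ → Ω' → S} (hX : IsMarkovChain μ X P)
    (hY : IsMarkovChain ν Y P) {l : S} (hl : ν {ω | Y 0 ω = l} = 1) (j : S) (n : ℕ) (s : S) :
    μ ({ω | X 0 ω = l} ∩ avoidSet X j n ∩ {ω | X (n + 1) ω = s}) =
      μ {ω | X 0 ω = l} * ν (avoidSet Y j n ∩ {ω | Y (n + 1) ω = s}) := by
  have hYl : ∀ A : Set Ω', ν (A ∩ {ω | Y 0 ω = l}) = ν A := fun A => by
    refine measure_inter_conull ?_
    exact (prob_compl_eq_zero_iff (hY.measurable 0 (measurableSet_singleton l))).2 hl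
  induction n generalizing s with
  | zero =>
    have h1 := hX.measure_inter_next (isPast_univ X 0) l s
    have h2 := hY.measure_inter_next (isPast_univ Y 0) l s
    rw [Set.univ_inter] at h1 h2
    rw [hl, one_mul, Set.inter_comm, hYl] at h2
    rw [avoidSet_zero, avoidSet_zero, Set.inter_univ, Set.univ_inter, h1, h2]
  | succ n ih =>
    have hXm : MeasurableSet ({ω | X 0 ω = l} ∩ avoidSet X j (n + 1) ∩ {ω | X (n + 1 + 1) ω = s}) :=
      ((hX.measurable 0 (measurableSet_singleton l)).inter
        (measurableSet_avoidSet hX.measurable j _)).inter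
        (hX.measurable _ (measurableSet_singleton s))
    have hYm : MeasurableSet (avoidSet Y j (n + 1) ∩ {ω | Y (n + 1 + 1) ω = s}) :=
      (measurableSet_avoidSet hY.measurable j _).inter
        (hY.measurable _ (measurableSet_singleton s))
    rw [measure_eq_tsum_inter_preimage μ (hX.measurable (n + 1)) hXm,
      measure_eq_tsum_inter_preimage ν (hY.measurable (n + 1)) hYm, ← ENNReal.tsum_mul_left]
    refine tsum_congr fun r => ?_
    rw [Set.inter_right_comm, Set.inter_right_comm (avoidSet Y j (n + 1)),
      hX.measure_inter_next ((isPast_eq X (Nat.zero_le _) l).inter (isPast_avoidSet X j (n + 1))),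
      hY.measure_inter_next (isPast_avoidSet Y j (n + 1)), ← mul_assoc]
    congr 1
    rw [Set.inter_assoc]
    rcases eq_or_ne r j with rfl | hr
    · simp [avoidSet_succ_inter_self]
    · rw [avoidSet_succ_inter_of_ne X hr, avoidSet_succ_inter_of_ne Y hr, ← Set.inter_assoc, ih]

end Chain

/-! ### The chain on the space of trajectories -/

instance (P : S → PMF S) (i : S) : IsProbabilityMeasure (pathMeasure P i) := by
  unfold pathMeasure
  infer_instance

lemma pathMeasure_zero (P : S → PMF S) (i : S) : pathMeasure P i {x | x 0 = i} = 1 := by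
  have h : (pathMeasure P i).map (Preorder.frestrictLe 0) =
      Measure.dirac (fun _ : Finset.Iic 0 => i) := by
    rw [pathMeasure, Kernel.traj_map_frestrictLe_apply, Kernel.partialTraj_self, Kernel.id_apply]
  have hm : MeasurableSet {y : Finset.Iic 0 → S | y ⟨0, Finset.mem_Iic.2 le_rfl⟩ = i} :=
    (measurable_pi_apply (X := fun _ : Finset.Iic 0 => S) ⟨0, Finset.mem_Iic.2 le_rfl⟩)
      (measurableSet_singleton i)
  have h1 := Measure.map_apply (μ := pathMeasure P i) (Preorder.measurable_frestrictLe 0) hm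
  rw [h, Measure.dirac_apply' _ hm] at h1
  simpa [eq_comm] using h1

/-- Under `pathMeasure P i`, the coordinate process is a Markov chain with transition matrix
`P`. -/
lemma isMarkovChain_pathMeasure (P : S → PMF S) (i : S) :
    IsMarkovChain (pathMeasure P i) (fun n (x : ℕ → S) => x n) P where
  measurable n := measurable_pi_apply n
  markov n x h0 := by
    have hC : MeasurableSet {y : Finset.Iic n → S | ∀ k, y k = x k} := by
      have : {y : Finset.Iic n → S | ∀ k, y k = x k} =
          {fun k : Finset.Iic n => x k} :=
        Set.ext fun _ => funext_iff.symm
      rw [this]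
      exact measurableSet_singleton _
    have hpre : {ω : ℕ → S | ∀ k ≤ n, ω k = x k} =
        Preorder.frestrictLe n ⁻¹' {y : Finset.Iic n → S | ∀ k, y k = x k} := by
      ext ω
      simp [Preorder.frestrictLe]
    have hmeas : MeasurableSet {ω : ℕ → S | ∀ k ≤ n, ω k = x k} := by
      rw [hpre]
      exact Preorder.measurable_frestrictLe n hC
    have hlaw := Kernel.partialTraj_compProd_eq_map_traj (X := fun _ => S) (κ := histKernel P)
      (Nat.zero_le n) (x₀ := fun _ => i)
    have hjoint : pathMeasure P i
        ({ω | ∀ k ≤ n, ω k = x k} ∩ {ω | ω (n + 1) = x (n + 1)}) =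
        pathMeasure P i {ω | ∀ k ≤ n, ω k = x k} * P (x n) (x (n + 1)) := by
      have hprod : MeasurableSet ({y : Finset.Iic n → S | ∀ k, y k = x k} ×ˢ {x (n + 1)}) :=
        hC.prod (measurableSet_singleton _)
      have h1 := congrArg (fun ρ => ρ ({y : Finset.Iic n → S | ∀ k, y k = x k} ×ˢ {x (n + 1)})) hlaw
      beta_reduce at h1
      rw [Measure.map_apply (by fun_prop) hprod,
        Measure.compProd_apply_prod hC (measurableSet_singleton _)] at h1
      have h2 : ∀ y ∈ {y : Finset.Iic n → S | ∀ k, y k = x k},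
          histKernel P n y {x (n + 1)} = P (x n) (x (n + 1)) := by
        intro y hy
        change (P (y ⟨n, _⟩)).toMeasure {x (n + 1)} = _
        rw [PMF.toMeasure_apply_singleton _ _ (measurableSet_singleton _), hy]
      rw [setLIntegral_congr_fun hC h2, setLIntegral_const,
        ← Kernel.traj_map_frestrictLe_apply,
        Measure.map_apply (Preorder.measurable_frestrictLe n) hC, ← hpre, mul_comm] at h1
      rw [pathMeasure, h1, hpre]
      rfl
    rw [cond_apply hmeas, hjoint, ← mul_assoc, ENNReal.inv_mul_cancel h0 (measure_ne_top _ _),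
      one_mul]

/-- The entries of the powers of `P` are the `n`-step transition probabilities. -/
lemma pathMeasure_eq_matPow (P : S → PMF S) (i j : S) (n : ℕ) :
    pathMeasure P i {x | x n = j} = matPow P n i j := by
  have h := (isMarkovChain_pathMeasure P i).measure_inter_add (isPast_univ _ 0) i n j
  rw [Set.univ_inter, pathMeasure_zero, one_mul, Nat.zero_add, Set.inter_comm] at h
  rw [← h]
  refine (measure_inter_conull ?_).symm
  have hm : MeasurableSet {x : ℕ → S | x 0 = i} :=
    (isMarkovChain_pathMeasure P i).measurable 0 (measurableSet_singleton i)
  exact (prob_compl_eq_zero_iff hm).2 (pathMeasure_zero P i)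

/-! ### The mean return time as a sum of tails -/

lemma meanReturnTime_eq_tsum (P : S → PMF S) (j : S) :
    meanReturnTime P j =
      ∑' k, pathMeasure P j (avoidSet (fun n (x : ℕ → S) => x n) j k) := by
  have hm := measurableSet_avoidSet (isMarkovChain_pathMeasure P j).measurable j
  simp only [meanReturnTime, returnTime_eq_tsum]
  rw [lintegral_tsum fun k => (measurable_one.indicator (hm k)).aemeasurable]
  exact tsum_congr fun k => lintegral_indicator_one (hm k)

/-- A finite mean return time makes the return certain, so `j` fails to be positive recurrent only
if its mean return time is infinite. -/
lemma meanReturnTime_eq_top_of_not_isPositiveRecurrent {P : S → PMF S} {j : S}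
    (h : ¬ IsPositiveRecurrent P j) : meanReturnTime P j = ∞ := by
  by_contra hfin
  refine h ⟨?_, lt_top_iff_ne_top.2 hfin⟩
  have hmeas : Measurable (returnTime j : (ℕ → S) → ℝ≥0∞) := by
    rw [funext (returnTime_eq_tsum j)]
    exact Measurable.tsum fun k => measurable_one.indicator
      (measurableSet_avoidSet (isMarkovChain_pathMeasure P j).measurable j k)
  have hae : ∀ᵐ x ∂pathMeasure P j, x ∈ {x : ℕ → S | ∃ n, 1 ≤ n ∧ x n = j} := by
    filter_upwards [ae_lt_top hmeas hfin] with x hx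
    obtain ⟨n, hn⟩ := iInf_lt_iff.1 hx
    obtain ⟨hn', -⟩ := iInf_lt_iff.1 hn
    exact ⟨n, hn'⟩
  have h1 : pathMeasure P j {x : ℕ → S | ∃ n, 1 ≤ n ∧ x n = j} = 1 :=
    (mem_ae_iff_prob_eq_one (measurableSet_hitSet
      (isMarkovChain_pathMeasure P j).measurable j)).1 hae
  rw [hitProb, measureReal_def, h1, ENNReal.toReal_one]

/-! ### Averages of visit probabilities -/

/-- The averages of the return probabilities `(P ^ n) j j` tend to the inverse of the mean return
time. -/
lemma tendsto_average_matPow_self (P : S → PMF S) (j : S) :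
    Tendsto (fun N : ℕ => (∑ b ∈ Finset.range N, (matPow P b j j).toReal) / N) atTop
      (𝓝 ((meanReturnTime P j)⁻¹).toReal) := by
  set Y : ℕ → (ℕ → S) → S := fun n x => x n with hY
  have hYc : IsMarkovChain (pathMeasure P j) Y P := isMarkovChain_pathMeasure P j
  have hconv := sum_tail_mul_sum_renewal
    (f := fun k => (pathMeasure P j).real (firstHitSet Y j k))
    (r := fun k => (pathMeasure P j).real (avoidSet Y j k))
    (u := fun k => (matPow P k j j).toReal) (by simp [matPow])
    (by simp [avoidSet_zero])
    (fun k => by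
      rw [avoidSet_succ, measureReal_sdiff (s₂ := firstHitSet Y j k) Set.inter_subset_left
        (measurableSet_firstHitSet hYc.measurable j k)])
    (fun n => by
      rw [← pathMeasure_eq_matPow, hYc.measure_eq_sum_firstHitSet j n,
        ENNReal.toReal_sum fun k _ =>
          ENNReal.mul_ne_top (measure_ne_top _ _) (PMF.apply_ne_top _ _)]
      simp only [ENNReal.toReal_mul, measureReal_def])
  have h := tendsto_average_renewal (r := fun k => (pathMeasure P j).real (avoidSet Y j k))
    (by simp [avoidSet_zero]) (fun k => measureReal_nonneg) (fun k => ENNReal.toReal_nonneg)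
    (fun k => ENNReal.toReal_mono ENNReal.one_ne_top (PMF.coe_le_one _ _)) hconv
  rw [tsum_congr fun k => ofReal_measureReal] at h
  rwa [meanReturnTime_eq_tsum]

variable {μ : Measure Ω} [IsProbabilityMeasure μ] {X : ℕ → Ω → S} {P : S → PMF S}

/-- The averages of the probabilities of visiting `j` tend to the probability of ever visiting `j`
divided by the mean return time. The inverse is taken in `ℝ≥0∞`, so that it is `0` for an infinite
mean return time. -/
lemma IsMarkovChain.tendsto_average (hX : IsMarkovChain μ X P) (j : S) :
    Tendsto (fun n : ℕ => (∑ k ∈ Finset.Icc 1 n, μ.real {ω | X k ω = j}) / n) atTop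
      (𝓝 (μ.real (hitSet X j) * ((meanReturnTime P j)⁻¹).toReal)) := by
  have hm := measurableSet_firstHitSet hX.measurable j
  have hd := pairwise_disjoint_firstHitSet X j
  have hhit : HasSum (fun k => μ.real (firstHitSet X j k)) (μ.real (hitSet X j)) := by
    have h1 : μ (hitSet X j) = ∑' k, μ (firstHitSet X j k) := by
      rw [hitSet_eq_iUnion, measure_iUnion hd hm]
    have hne : ∑' k, μ (firstHitSet X j k) ≠ ∞ := h1 ▸ measure_ne_top _ _
    rw [measureReal_def, h1, ENNReal.tsum_toReal_eq fun k => measure_ne_top _ _]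
    exact (ENNReal.summable_toReal hne).hasSum
  rw [← hhit.tsum_eq]
  refine tendsto_average_delayed_renewal (fun k => measureReal_nonneg) hhit.summable
    (u := fun k => (matPow P k j j).toReal) (fun k => ENNReal.toReal_nonneg)
    (fun k => ENNReal.toReal_mono ENNReal.one_ne_top (PMF.coe_le_one _ _))
    (tendsto_average_matPow_self P j) fun n => ?_
  rw [measureReal_def, hX.measure_eq_sum_firstHitSet j n, ENNReal.toReal_sum fun k _ =>
    ENNReal.mul_ne_top (measure_ne_top _ _) (PMF.apply_ne_top _ _)]
  simp only [ENNReal.toReal_mul, measureReal_def]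

/-- Conditioning on the initial state: the probability of hitting `j` is the mean of `hitProb P l j`
under the initial distribution. -/
lemma IsMarkovChain.hasSum_hitProb (hX : IsMarkovChain μ X P) (j : S) :
    HasSum (fun l => μ.real {ω | X 0 ω = l} * hitProb P l j) (μ.real (hitSet X j)) := by
  have hterm : ∀ l, μ (hitSet X j ∩ {ω | X 0 ω = l}) =
      μ {ω | X 0 ω = l} * pathMeasure P l (hitSet (fun n (x : ℕ → S) => x n) j) := by
    intro l
    have hYc := isMarkovChain_pathMeasure P l
    have hlm : MeasurableSet {ω | X 0 ω = l} := hX.measurable 0 (measurableSet_singleton l)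
    rw [hitSet_eq_iUnion, hitSet_eq_iUnion, Set.iUnion_inter,
      measure_iUnion (fun a b hab => (pairwise_disjoint_firstHitSet X j hab).mono
        Set.inter_subset_left Set.inter_subset_left)
        fun k => (measurableSet_firstHitSet hX.measurable j k).inter hlm,
      measure_iUnion (pairwise_disjoint_firstHitSet _ j)
        (measurableSet_firstHitSet hYc.measurable j), ← ENNReal.tsum_mul_left]
    refine tsum_congr fun k => ?_
    rw [firstHitSet, Set.inter_right_comm, Set.inter_comm (avoidSet X j k)]
    exact hX.measure_avoidSet_inter hYc (pathMeasure_zero P l) j k j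
  have hsum := measure_eq_tsum_inter_preimage μ (hX.measurable 0)
    (measurableSet_hitSet hX.measurable j)
  have hne : ∑' l, μ (hitSet X j ∩ {ω | X 0 ω = l}) ≠ ∞ := hsum ▸ measure_ne_top _ _
  have h : HasSum (fun l => (μ (hitSet X j ∩ {ω | X 0 ω = l})).toReal) (μ.real (hitSet X j)) := by
    rw [measureReal_def, hsum, ENNReal.tsum_toReal_eq fun l => measure_ne_top _ _]
    exact (ENNReal.summable_toReal hne).hasSum
  refine h.congr_fun fun l => ?_
  rw [hterm, ENNReal.toReal_mul]
  rfl

end CountableMarkovChain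

open CountableMarkovChain in
theorem mainTheorem1 {S : Type*} [Countable S] [MeasurableSpace S] [DiscreteMeasurableSpace S]
    {Ω : Type*} [MeasurableSpace Ω] (μ : Measure Ω) [IsProbabilityMeasure μ]
    (P : S → PMF S) (X : ℕ → Ω → S) (hX : IsMarkovChain μ X P) (i j : S) :
    ((IsPositiveRecurrent P j →
        Summable (fun l : S => μ.real {ω | X 0 ω = l} * hitProb P l j) ∧
        Tendsto (fun n : ℕ => (1 / (n : ℝ)) * ∑ k ∈ Finset.Icc 1 n, μ.real {ω | X k ω = j})
          atTop (𝓝 (1 / (meanReturnTime P j).toReal *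
            ∑' l : S, μ.real {ω | X 0 ω = l} * hitProb P l j))) ∧
      (¬ IsPositiveRecurrent P j →
        Tendsto (fun n : ℕ => (1 / (n : ℝ)) * ∑ k ∈ Finset.Icc 1 n, μ.real {ω | X k ω = j})
          atTop (𝓝 0))) ∧
    ((IsPositiveRecurrent P j →
        Tendsto (fun n : ℕ => (∑ k ∈ Finset.Icc 1 n, (matPow P k i j).toReal) / (n : ℝ))
          atTop (𝓝 (hitProb P i j / (meanReturnTime P j).toReal))) ∧
      (¬ IsPositiveRecurrent P j →
        Tendsto (fun n : ℕ => (∑ k ∈ Finset.Icc 1 n, (matPow P k i j).toReal) / (n : ℝ))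
          atTop (𝓝 0))) := by
  have h1 := hX.tendsto_average j
  have hsum := hX.hasSum_hitProb j
  have h2 : Tendsto (fun n : ℕ => (∑ k ∈ Finset.Icc 1 n, (matPow P k i j).toReal) / (n : ℝ))
      atTop (𝓝 (hitProb P i j * ((meanReturnTime P j)⁻¹).toReal)) := by
    have h := (isMarkovChain_pathMeasure P i).tendsto_average j
    simp only [measureReal_def (pathMeasure P i) {x | _ = j}, pathMeasure_eq_matPow] at h
    exact h
  refine ⟨⟨fun _ => ⟨hsum.summable, ?_⟩, fun hj => ?_⟩, fun _ => ?_, fun hj => ?_⟩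
  · rw [hsum.tsum_eq, one_div, ← ENNReal.toReal_inv, mul_comm]
    simpa only [div_eq_inv_mul, mul_one] using h1
  · rw [meanReturnTime_eq_top_of_not_isPositiveRecurrent hj] at h1
    simpa [div_eq_inv_mul] using h1
  · rwa [div_eq_mul_inv, ← ENNReal.toReal_inv]
  · rw [meanReturnTime_eq_top_of_not_isPositiveRecurrent hj] at h2
    simpa using h2
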